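/- A finite-state transducer (FST) is a tuple $T=\langle Q,q_0,\delta,\lambda\rangle$ with a finite set of states $Q$, an initial state $q_0\in Q$, a transition function $\delta:Q\times\{0,1\}\to Q$ and an output function $\lambda:Q\times\{0,1\}\to\{0,1\}^*$; it maps an infinite binary sequence $a_0a_1a_2\cdots$ to the concatenation $\lambda(q_0,a_0)\,\lambda(q_1,a_1)\,\lambda(q_2,a_2)\cdots$, where $q_{i+1}=\delta(q_i,a_i)$. For $\sigma,\tau\in\{0,1\}^{\mathbb N}$ write $\sigma\ge\tau$, and call $\tau$ a transduct of $\sigma$, if some FST maps $\sigma$ to $\tau$. This relation is a preorder; the classes $[\sigma]$ of the equivalence relation ($\sigma\ge\tau$ and $\tau\ge\sigma$) are called degrees, and they are partially ordered by $\ge$. The least degree $\mathbf 0$ is the class of the ultimately periodic sequences. A degree $D\ne\mathbf 0$ is an atom if there is no degree $E$ with $D>E>\mathbf 0$. **Theorem.** There is a degree different from $\mathbf 0$ that is not an atom and has no atom degree below it. Namely, this holds for the degree of $$\sigma=\langle 2^n\rangle=1\,0^{2^0}\,1\,0^{2^1}\,1\,0^{2^2}\,1\,0^{2^3}\cdots.$$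 Moreover, for every transduct $\tau$ of $\sigma$ with $[\tau]\ne\mathbf 0$ there is an infinite strictly descending chain of degrees $[\tau]=D_0>D_1>D_2>\cdots$. -/

import Mathlib

/-- Infinite binary sequences, with `false` for the letter `0` and `true` for the letter `1`. -/
def BinSeq : Type := ℕ → Bool

namespace BinSeq

/-- The prefix of length `n` of an infinite sequence. -/
def pre (σ : BinSeq) (n : ℕ) : List Bool := List.ofFn fun i : Fin n => σ i

end BinSeq

/-- Complete pure sequential finite-state transducers over the binary alphabet. -/
structure FST where
  State : Type
  finite : Finite State
  start : State
  step : State → Bool → State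
  out : State → Bool → List Bool

namespace FST

/-- The extension of the transition function to finite words. -/
def run (T : FST) : T.State → List Bool → T.State
  | q, [] => q
  | q, a :: u => T.run (T.step q a) u

/-- The extension of the output function to finite words. -/
def output (T : FST) : T.State → List Bool → List Bool
  | _, [] => []
  | q, a :: u => T.out q a ++ T.output (T.step q a) u

/-- `T` transduces the infinite sequence `σ` to the infinite sequence `τ`: the outputs on the finite
prefixes of `σ` are prefixes of `τ`, and their lengths are unbounded. Equivalently, the infinite
concatenation of the words that `T` outputs when it reads `σ` is the infinite sequence `τ`. -/
def Transduces (T : FST) (σ τ : BinSeq) : Prop :=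
  (∀ m, T.output T.start (σ.pre m) = τ.pre (T.output T.start (σ.pre m)).length) ∧
    ∀ n, ∃ m, n ≤ (T.output T.start (σ.pre m)).length

/-- The transducer that copies its input. -/
def copy : FST where
  State := Unit
  finite := inferInstance
  start := ()
  step := fun _ _ => ()
  out := fun _ a => [a]

/-- The transducer that outputs `0` for every letter that it reads. -/
def toZeros : FST where
  State := Unit
  finite := inferInstance
  start := ()
  step := fun _ _ => ()
  out := fun _ _ => [false]

/-- The composition (wreath product) of transducers: first `T`, then `S`. -/
def comp (S T : FST) : FST where
  State := T.State × S.State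
  finite := by
    have := T.finite
    have := S.finite
    infer_instance
  start := (T.start, S.start)
  step := fun q a => (T.step q.1 a, S.run q.2 (T.out q.1 a))
  out := fun q a => S.output q.2 (T.out q.1 a)

theorem output_append (T : FST) (u v : List Bool) (q : T.State) :
    T.output q (u ++ v) = T.output q u ++ T.output (T.run q u) v := by
  induction u generalizing q with
  | nil => simp [output, run]
  | cons a u ih => simp [output, run, ih]

theorem output_comp (S T : FST) (u : List Bool) (q : T.State) (r : S.State) :
    (comp S T).output (q, r) u = S.output r (T.output q u) := by
  induction u generalizing q r with
  | nil => simp [output]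
  | cons a u ih =>
    have h := ih (T.step q a) (S.run r (T.out q a))
    simp only [output, output_append, ← h]
    rfl

theorem output_copy (u : List Bool) (q : copy.State) : copy.output q u = u := by
  induction u generalizing q with
  | nil => rfl
  | cons a u ih =>
    rw [output, ih]
    rfl

theorem output_toZeros (u : List Bool) (q : toZeros.State) :
    toZeros.output q u = List.replicate u.length false := by
  induction u generalizing q with
  | nil => rfl
  | cons a u ih =>
    rw [output, ih]
    rfl

end FST

namespace BinSeq

theorem length_pre (σ : BinSeq) (n : ℕ) : (σ.pre n).length = n := by simp [pre]

theorem pre_add (σ : BinSeq) (m k : ℕ) : ∃ v, σ.pre (m + k) = σ.pre m ++ v :=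
  ⟨_, by simp only [pre, List.ofFn_add]; rfl⟩

/-- The sequence `σ` can be transduced to `τ`. -/
def TransducesTo (σ τ : BinSeq) : Prop := ∃ T : FST, T.Transduces σ τ

theorem TransducesTo.refl (σ : BinSeq) : σ.TransducesTo σ :=
  ⟨FST.copy, fun m => by simp [FST.output_copy, length_pre],
    fun n => ⟨n, by simp [FST.output_copy, length_pre]⟩⟩

theorem TransducesTo.trans {σ τ ρ : BinSeq} (h : σ.TransducesTo τ) (h' : τ.TransducesTo ρ) :
    σ.TransducesTo ρ := by
  obtain ⟨T, hT, hTu⟩ := h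
  obtain ⟨S, hS, hSu⟩ := h'
  have key : ∀ m, (FST.comp S T).output (FST.comp S T).start (σ.pre m) =
      S.output S.start (τ.pre (T.output T.start (σ.pre m)).length) := by
    intro m
    rw [← hT m]
    exact FST.output_comp S T _ _ _
  refine ⟨FST.comp S T, fun m => ?_, fun n => ?_⟩
  · rw [key]
    exact hS _
  · obtain ⟨k, hk⟩ := hSu n
    obtain ⟨m, hm⟩ := hTu k
    refine ⟨m, ?_⟩
    rw [key]
    obtain ⟨d, hd⟩ := Nat.exists_eq_add_of_le hm
    obtain ⟨v, hv⟩ := τ.pre_add k d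
    rw [hd, hv, FST.output_append, List.length_append]
    omega

/-- `τ ≤ σ` means that `τ` is a transduct of `σ`. -/
instance : Preorder BinSeq where
  le := fun τ σ => σ.TransducesTo τ
  le_refl := TransducesTo.refl
  le_trans := fun _ _ _ h h' => h'.trans h

/-- The sequence `0 0 0 ⋯`. -/
def zeros : BinSeq := fun _ => false

theorem zeros_le (σ : BinSeq) : zeros ≤ σ := by
  refine ⟨FST.toZeros, fun m => ?_, fun n => ⟨n, ?_⟩⟩
  · simp only [FST.output_toZeros, length_pre, List.length_replicate]
    simp [pre, zeros]
  · simp [FST.output_toZeros, length_pre]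

/-- The sequence `1 0^{f 0} 1 0^{f 1} 1 0^{f 2} ⋯`. Its `k`-th letter is read off from the
concatenation of the first `k + 1` blocks, which has length at least `k + 1`. -/
def ofBlocks (f : ℕ → ℕ) : BinSeq := fun k =>
  ((List.range (k + 1)).flatMap fun i => true :: List.replicate (f i) false).getD k false

end BinSeq

/-- The FST degrees: the classes of sequences that can be transduced to each other, ordered by
transducibility. -/
abbrev Degree : Type := Antisymmetrization BinSeq (· ≤ ·)

/-- The degree of a sequence. -/
def BinSeq.degree (σ : BinSeq) : Degree := toAntisymmetrization (· ≤ ·) σ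

/-- The bottom degree is the degree of `0 0 0 ⋯` (it consists of the ultimately periodic
sequences). -/
instance : OrderBot Degree where
  bot := BinSeq.zeros.degree
  bot_le := fun d => by
    induction d using Antisymmetrization.ind with
    | _ σ => exact toAntisymmetrization_le_toAntisymmetrization_iff.2 σ.zeros_le

/-! Fix a transduct `τ` of `powTwo` that is not ultimately periodic. On a long run of zeros a
transducer enters a loop, so its output for a block `1 0 ⋯ 0` is periodic up to boundedly many
letters. With `L` a common multiple of all periods that can occur, `xorShift L τ` receives boundedly
many ones per block (`exists_ones_xorShift_le`). The output grows linearly, since otherwise `τ`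
would be ultimately periodic (`exists_two_pow_le`). Doubling the output position therefore takes
boundedly many blocks, hence boundedly many ones: this is `HasLogOnes`. Keeping every `n`-th one for
a suitable `n` gives a sparse `ρ ≤ τ` with infinitely many ones.

Dropping every second one of `ρ` lowers the degree (`not_le_thin_two`). Up to a constant, a
transducer with sparse output writes at most one `1` per `1` read (`exists_ones_le_ones`). From `M`
letters of `thin 2 ρ` it would thus write at most about half as many ones as `ρ` has before `M`. Yet
for suitable large `M` it writes a number of letters proportional to `M`, and by logarithmic growth
`ρ` has, up to a constant, as many ones there as before `M`. The same count shows that `thin 2 ρ` is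
not ultimately periodic, so its degree lies strictly between `⊥` and that of `τ`. -/

namespace BinSeq

/-! ### Factors and periodicity. -/

/-- The factor of length `m` that starts at position `a`. -/
def window (σ : BinSeq) (a m : ℕ) : List Bool := List.ofFn fun i : Fin m => σ (a + i)

theorem pre_add_eq (σ : BinSeq) (a m : ℕ) : σ.pre (a + m) = σ.pre a ++ σ.window a m := by
  simp only [pre, window, List.ofFn_add]; rfl

theorem window_eq_iff {σ : BinSeq} {a m : ℕ} {w : List Bool} (hw : w.length = m) :
    σ.window a m = w ↔ ∀ i (h : i < w.length), σ (a + i) = w[i] := by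
  subst hw
  rw [List.ext_get_iff]
  simp [window]

theorem window_one (σ : BinSeq) (a : ℕ) : σ.window a 1 = [σ a] := by simp [window]

theorem window_eq_replicate {σ : BinSeq} {a m : ℕ} (h : ∀ i < m, σ (a + i) = false) :
    σ.window a m = List.replicate m false := by
  rw [window_eq_iff (by simp)]
  intro i hi
  simpa using h i (by simpa using hi)

/-- If consecutive factors of a sequence repeat after `d` steps, then the sequence is periodic on
the stretch that they cover. -/
theorem chunk_shift {τ : BinSeq} {P : ℕ → ℕ} {W : ℕ → List Bool}
    (hP : ∀ n, P (n + 1) = P n + (W n).length)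
    (hW : ∀ n, τ.window (P n) (W n).length = W n) {a b d ℓ : ℕ} (hab : a ≤ b)
    (hd : ∀ n, a ≤ n → n < b → W (n + d) = W n) (hℓ : P (a + d) = P a + ℓ) :
    (∀ n, a ≤ n → n ≤ b → P (n + d) = P n + ℓ) ∧
      ∀ k, P a ≤ k → k < P b → τ (k + ℓ) = τ k := by
  induction b, hab using Nat.le_induction with
  | base =>
    refine ⟨fun n h1 h2 => ?_, fun k h1 h2 => by omega⟩
    obtain rfl : n = a := by omega
    exact hℓ
  | succ b hab ih =>
    obtain ⟨ih1, ih2⟩ := ih fun n h1 h2 => hd n h1 (by omega)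
    have e := hd b hab (by omega)
    have hb := ih1 b hab le_rfl
    refine ⟨fun n h1 h2 => ?_, fun k h1 h2 => ?_⟩
    · rcases Nat.lt_or_ge n (b + 1) with h | h
      · exact ih1 n h1 (by omega)
      · obtain rfl : n = b + 1 := by omega
        have h3 := hP (b + d)
        rw [e] at h3
        have h4 := hP b
        rw [show b + 1 + d = b + d + 1 by ring]
        omega
    · rcases Nat.lt_or_ge k (P b) with h | h
      · exact ih2 k h1 h
      · have h3 := hP b
        obtain ⟨i, rfl⟩ := Nat.exists_eq_add_of_le h
        have hi : i < (W b).length := by omega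
        have h4 := (window_eq_iff rfl).1 (hW b) i hi
        have h5 := (window_eq_iff rfl).1 (hW (b + d)) i (by rw [e]; exact hi)
        rw [show P b + i + ℓ = P (b + d) + i by omega, h5, h4]
        simp only [e]

/-- The case `ℓ = 0` of `chunk_shift`, where no period is available: a whole cycle of chunks is
empty. -/
theorem chunk_const {P : ℕ → ℕ} (hP : Monotone P) {a b d : ℕ} (hd : 0 < d)
    (h : ∀ n, a ≤ n → n ≤ b → P (n + d) = P n) {n : ℕ} (h1 : a ≤ n) (h2 : n ≤ b) : P n = P a := by
  induction n, h1 using Nat.le_induction with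
  | base => rfl
  | succ n hn ih =>
    have h3 := ih (by omega)
    have h4 := h n hn (by omega)
    have h5 : P (n + 1) ≤ P (n + d) := hP (by omega)
    have h6 : P n ≤ P (n + 1) := hP (by omega)
    omega

/-! ### Letter-to-letter transductions. -/

/-- A criterion for transducibility by a machine that outputs one letter for each letter. -/
theorem transducesTo_of_mealy {σ τ : BinSeq} {Q : Type} [Finite Q] (st : ℕ → Q)
    (step : Q → Bool → Q) (out : Q → Bool → Bool) (hst : ∀ k, st (k + 1) = step (st k) (σ k))
    (hout : ∀ k, τ k = out (st k) (σ k)) : σ.TransducesTo τ := by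
  let T : FST := ⟨Q, inferInstance, st 0, step, fun q a => [out q a]⟩
  have key : ∀ m, T.run T.start (σ.pre m) = st m ∧ T.output T.start (σ.pre m) = τ.pre m := by
    intro m
    have run_append : ∀ (u v : List Bool) (q : T.State), T.run q (u ++ v) = T.run (T.run q u) v := by
      intro u v
      induction u with
      | nil => intro q; rfl
      | cons a u ih => intro q; exact ih _
    induction m with
    | zero => exact ⟨rfl, rfl⟩
    | succ m ih =>
      rw [pre_add_eq, pre_add_eq, window_one, window_one, run_append, FST.output_append, ih.1, ih.2]
      refine ⟨(hst m).symm, ?_⟩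
      rw [hout m]
      rfl
  refine ⟨T, fun m => ?_, fun n => ⟨n, ?_⟩⟩
  · rw [(key m).2, length_pre]
  · rw [(key n).2, length_pre]

theorem le_zeros_of_periodic {τ : BinSeq} {k₀ L : ℕ} (hL : 0 < L)
    (h : ∀ k, k₀ ≤ k → τ (k + L) = τ k) : τ ≤ zeros := by
  have hlt : ∀ k, (if k < k₀ then k else k₀ + (k - k₀) % L) < k₀ + L := by
    intro k
    have := Nat.mod_lt (k - k₀) hL
    split_ifs <;> omega
  -- The state is the current position, folded back into the first period after `k₀`.
  refine transducesTo_of_mealy (Q := Fin (k₀ + L))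
    (fun k => ⟨if k < k₀ then k else k₀ + (k - k₀) % L, hlt k⟩)
    (fun q _ => ⟨if q.1 + 1 < k₀ then q.1 + 1 else k₀ + (q.1 + 1 - k₀) % L, hlt _⟩)
    (fun q _ => τ q) (fun k => ?_) (fun k => ?_)
  · ext
    dsimp only
    by_cases hk : k < k₀
    · simp [hk]
    · rw [if_neg (by omega : ¬ k + 1 < k₀), if_neg (by split_ifs; omega), if_neg hk,
        show k + 1 - k₀ = k - k₀ + 1 by omega,
        show k₀ + (k - k₀) % L + 1 - k₀ = (k - k₀) % L + 1 by omega, Nat.mod_add_mod]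
  · dsimp only
    by_cases hk : k < k₀
    · simp [hk]
    · rw [if_neg hk]
      have : ∀ j i, τ (k₀ + i + L * j) = τ (k₀ + i) := by
        intro j i
        induction j with
        | zero => simp
        | succ j ih => rw [Nat.mul_succ, ← add_assoc, h _ (by omega), ih]
      have h2 := this ((k - k₀) / L) ((k - k₀) % L)
      rw [add_assoc, Nat.mod_add_div] at h2
      rw [← h2]
      congr 1
      omega

/-- The positions at which `τ` differs from its shift by `L` (the sequence being preceded by
zeros). -/
def xorShift (L : ℕ) (τ : BinSeq) : BinSeq := fun k => xor (τ k) (decide (L ≤ k) && τ (k - L))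

theorem xorShift_add (L : ℕ) (τ : BinSeq) (k : ℕ) :
    xorShift L τ (k + L) = false ↔ τ (k + L) = τ k := by
  simp [xorShift]

theorem xorShift_le {L : ℕ} (hL : 0 < L) (τ : BinSeq) : xorShift L τ ≤ τ := by
  -- A shift register: cell `i` holds the letter read `i + 1` steps ago, initially `false`.
  refine transducesTo_of_mealy (Q := Fin L → Bool)
    (fun k i => decide (i.1 + 1 ≤ k) && τ (k - (i + 1)))
    (fun f b i => if i.1 = 0 then b else f ⟨i - 1, by omega⟩)
    (fun f b => xor b (f ⟨L - 1, by omega⟩)) (fun k => ?_) (fun k => ?_)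
  · funext i
    dsimp only
    by_cases hi : i.1 = 0
    · simp [hi]
    · rw [if_neg hi, show i.1 - 1 + 1 = i.1 by omega, show k + 1 - (i.1 + 1) = k - i.1 by omega]
      simp
  · dsimp only
    rw [show L - 1 + 1 = L by omega]
    rfl

/-! ### Counting ones, sparsity and thinning. -/

/-- The number of ones in the prefix of length `n`. -/
def ones (τ : BinSeq) : ℕ → ℕ
  | 0 => 0
  | n + 1 => ones τ n + if τ n = true then 1 else 0

theorem ones_mono (τ : BinSeq) : Monotone τ.ones :=
  monotone_nat_of_le_succ fun _ => Nat.le_add_right _ _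

theorem ones_succ (τ : BinSeq) (n : ℕ) : τ.ones (n + 1) = τ.ones n + if τ n = true then 1 else 0 :=
  rfl

theorem ones_add_le (τ : BinSeq) (n m : ℕ) : τ.ones (n + m) ≤ τ.ones n + m := by
  induction m with
  | zero => simp
  | succ m ih =>
    rw [← add_assoc, ones_succ]
    split_ifs <;> omega

theorem ones_eq_of_false {τ : BinSeq} {a b : ℕ} (hab : a ≤ b)
    (h : ∀ k, a ≤ k → k < b → τ k = false) : τ.ones b = τ.ones a := by
  induction b, hab using Nat.le_induction with
  | base => rfl
  | succ b hab ih =>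
    rw [ones_succ, h b hab (by omega), ih fun k h1 h2 => h k h1 (by omega)]
    simp

theorem ones_lt {τ : BinSeq} {a b : ℕ} (hab : a < b) (h : τ a = true) : τ.ones a < τ.ones b := by
  have h1 := τ.ones_mono (show a + 1 ≤ b from hab)
  rw [ones_succ, if_pos h] at h1
  omega

/-- The sequence has infinitely many ones. -/
def HasManyOnes (τ : BinSeq) : Prop := ∀ n, ∃ k, n ≤ k ∧ τ k = true

theorem HasManyOnes.exists_ones {τ : BinSeq} (h : τ.HasManyOnes) (n : ℕ) : ∃ m, n ≤ τ.ones m := by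
  induction n with
  | zero => exact ⟨0, by simp⟩
  | succ n ih =>
    obtain ⟨m, hm⟩ := ih
    obtain ⟨k, hk, hk'⟩ := h m
    have h1 := ones_lt (Nat.lt_succ_self k) hk'
    have h2 := τ.ones_mono hk
    exact ⟨k + 1, by simp only [Nat.succ_eq_add_one] at h1; omega⟩

/-- The distance between ones tends to infinity. -/
def IsSparse (τ : BinSeq) : Prop :=
  ∀ D, ∃ X, ∀ y z, X ≤ y → y < z → τ y = true → τ z = true → y + D < z

/-- The number of ones grows at most logarithmically, locally at every scale. -/
def HasLogOnes (τ : BinSeq) : Prop := ∃ C X, ∀ M, X ≤ M → τ.ones (2 * M) ≤ τ.ones M + C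

theorem HasLogOnes.mul {τ : BinSeq} (h : τ.HasLogOnes) (D : ℕ) :
    ∃ C X, ∀ M, X ≤ M → τ.ones (D * M) ≤ τ.ones M + C := by
  obtain ⟨C, X, h⟩ := h
  have key : ∀ j M, X ≤ M → τ.ones (2 ^ j * M) ≤ τ.ones M + j * C := by
    intro j M hM
    induction j with
    | zero => simp
    | succ j ih =>
      have h1 := h (2 ^ j * M) (hM.trans (Nat.le_mul_of_pos_left _ (by positivity)))
      rw [← mul_assoc, ← pow_succ'] at h1
      rw [Nat.succ_mul]
      omega
  exact ⟨D * C, X, fun M hM =>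
    (τ.ones_mono (Nat.mul_le_mul_right M Nat.lt_two_pow_self.le)).trans (key D M hM)⟩

/-- Keep every `n`-th one and replace the others by zeros. -/
def thin (n : ℕ) (τ : BinSeq) : BinSeq := fun k => τ k && decide (τ.ones k % n = 0)

theorem thin_le {n : ℕ} (hn : 0 < n) (τ : BinSeq) : thin n τ ≤ τ := by
  refine transducesTo_of_mealy (Q := Fin n) (fun k => ⟨τ.ones k % n, Nat.mod_lt _ hn⟩)
    (fun q b => ⟨(q.1 + if b = true then 1 else 0) % n, Nat.mod_lt _ hn⟩)
    (fun q b => b && decide (q.1 = 0)) (fun k => ?_) (fun k => rfl)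
  ext
  simp [ones_succ]

theorem of_thin {n : ℕ} {τ : BinSeq} {k : ℕ} (h : thin n τ k = true) :
    τ k = true ∧ τ.ones k % n = 0 := by simpa [thin] using h

theorem HasManyOnes.thin {τ : BinSeq} (h : τ.HasManyOnes) {n : ℕ} (hn : 0 < n) :
    (thin n τ).HasManyOnes := by
  intro m
  obtain ⟨M, hM⟩ := h.exists_ones (τ.ones m * n + n + 1)
  by_contra! hc
  -- The bound is a multiple of `n` exceeding `τ.ones m`. The one that would push the count past it
  -- lies beyond `m` and is kept by `thin`.
  have h1 : ∀ k, τ.ones k ≤ τ.ones m * n + n := by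
    intro k
    induction k with
    | zero => simp [ones]
    | succ k ih =>
      rw [ones_succ]
      split_ifs with hk
      · rcases ih.lt_or_eq with h2 | h2
        · omega
        · exfalso
          refine hc k ?_ ?_
          · by_contra! h3
            have := τ.ones_mono h3.le
            nlinarith
          · simp [BinSeq.thin, hk, h2]
      · omega
  have := h1 M
  omega

theorem HasLogOnes.thin {τ : BinSeq} (h : τ.HasLogOnes) (n : ℕ) : (thin n τ).HasLogOnes := by
  obtain ⟨C, X, h⟩ := h
  refine ⟨C, X, fun M hM => ?_⟩
  have key : ∀ j, (BinSeq.thin n τ).ones (M + j) + τ.ones M ≤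
      (BinSeq.thin n τ).ones M + τ.ones (M + j) := by
    intro j
    induction j with
    | zero => simp
    | succ j ih =>
      rw [← add_assoc, ones_succ, ones_succ]
      by_cases h1 : BinSeq.thin n τ (M + j) = true
      · rw [if_pos h1, if_pos (of_thin h1).1]
        omega
      · rw [if_neg h1]
        omega
  have h1 := key M
  have h2 := h M hM
  rw [← two_mul] at h1
  omega

theorem IsSparse.thin {τ : BinSeq} (h : τ.IsSparse) (n : ℕ) : (thin n τ).IsSparse := by
  intro D
  obtain ⟨X, hX⟩ := h D
  exact ⟨X, fun y z h1 h2 h3 h4 => hX y z h1 h2 (of_thin h3).1 (of_thin h4).1⟩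

theorem HasLogOnes.exists_thin_isSparse {τ : BinSeq} (h : τ.HasLogOnes) :
    ∃ n, 0 < n ∧ (BinSeq.thin n τ).IsSparse := by
  obtain ⟨C, X, h⟩ := h
  -- The counts at two kept ones differ by at least `C + 1`, but only `C` ones lie between `y` and
  -- `2 * y`. So `z` exceeds `2 * y`, which is at least `y + D`.
  refine ⟨C + 1, by omega, fun D => ⟨X + D, fun y z h1 h2 h3 h4 => ?_⟩⟩
  obtain ⟨h3, h3'⟩ := of_thin h3
  obtain ⟨h4, h4'⟩ := of_thin h4
  have h5 := ones_lt h2 h3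
  have h6 := h y (by omega)
  by_contra! hc
  have h7 := τ.ones_mono (show z ≤ 2 * y by omega)
  obtain ⟨u, hu⟩ := Nat.dvd_of_mod_eq_zero h3'
  obtain ⟨v, hv⟩ := Nat.dvd_of_mod_eq_zero h4'
  have h8 : u < v := by
    by_contra! h9
    have := Nat.mul_le_mul_left (C + 1) h9
    omega
  have := Nat.mul_le_mul_left (C + 1) (show u + 1 ≤ v from h8)
  rw [Nat.mul_add] at this
  omega

theorem two_mul_ones_thin_le (τ : BinSeq) (M : ℕ) :
    2 * (thin 2 τ).ones M ≤ τ.ones M + 1 := by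
  -- Rounded up, because the first one has count `0` and is kept.
  have : (thin 2 τ).ones M = (τ.ones M + 1) / 2 := by
    induction M with
    | zero => simp [ones]
    | succ M ih =>
      rw [ones_succ, ones_succ, ih]
      by_cases h : τ M = true
      · by_cases h2 : τ.ones M % 2 = 0
        · simp only [thin, h, h2]
          simp
          omega
        · simp [thin, h, h2]
          omega
      · simp [thin, h]
  omega

end BinSeq

/-! ### Transducers along a fixed input. -/

namespace FST

theorem run_append (T : FST) (u v : List Bool) (q : T.State) :
    T.run q (u ++ v) = T.run (T.run q u) v := by
  induction u generalizing q with
  | nil => rfl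
  | cons a u ih => exact ih _

/-- The state after `T` has read `k` letters of `σ`. -/
def stateAt (T : FST) (σ : BinSeq) (k : ℕ) : T.State := T.run T.start (σ.pre k)

/-- The length of the output after `T` has read `k` letters of `σ`. -/
def outLen (T : FST) (σ : BinSeq) (k : ℕ) : ℕ := (T.output T.start (σ.pre k)).length

theorem stateAt_add (T : FST) (σ : BinSeq) (a m : ℕ) :
    T.stateAt σ (a + m) = T.run (T.stateAt σ a) (σ.window a m) := by
  rw [stateAt, BinSeq.pre_add_eq, run_append]
  rfl

theorem outLen_add (T : FST) (σ : BinSeq) (a m : ℕ) :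
    T.outLen σ (a + m) =
      T.outLen σ a + (T.output (T.stateAt σ a) (σ.window a m)).length := by
  rw [outLen, BinSeq.pre_add_eq, output_append, List.length_append]
  rfl

theorem outLen_mono (T : FST) (σ : BinSeq) : Monotone (T.outLen σ) :=
  monotone_nat_of_le_succ fun n => by rw [outLen_add]; exact Nat.le_add_right _ _

theorem outLen_comp (S T : FST) {σ τ : BinSeq} (hT : T.Transduces σ τ) (k : ℕ) :
    (comp S T).outLen σ k = S.outLen τ (T.outLen σ k) := by
  have h : (comp S T).output (comp S T).start (σ.pre k) =
      S.output S.start (T.output T.start (σ.pre k)) := output_comp S T _ _ _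
  rw [outLen, h, hT.1 k]
  rfl

namespace Transduces

variable {T : FST} {σ τ : BinSeq}

theorem window_eq (hT : T.Transduces σ τ) (a m : ℕ) :
    τ.window (T.outLen σ a) (T.output (T.stateAt σ a) (σ.window a m)).length =
      T.output (T.stateAt σ a) (σ.window a m) := by
  have h := hT.1 (a + m)
  change _ = τ.pre (T.outLen σ (a + m)) at h
  rw [outLen_add, BinSeq.pre_add_eq, BinSeq.pre_add_eq, output_append, hT.1 a] at h
  exact (List.append_cancel_left h).symm

theorem exists_le_outLen (hT : T.Transduces σ τ) (n : ℕ) : ∃ m, n ≤ T.outLen σ m := hT.2 n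

theorem comp {S : FST} {ρ : BinSeq} (hS : S.Transduces τ ρ) (hT : T.Transduces σ τ) :
    (FST.comp S T).Transduces σ ρ := by
  have h : ∀ k, (FST.comp S T).output (FST.comp S T).start (σ.pre k) =
      S.output S.start (τ.pre (T.outLen σ k)) := fun k =>
    (output_comp S T _ _ _).trans (by rw [hT.1 k]; rfl)
  refine ⟨fun m => by rw [h]; exact hS.1 _, fun n => ?_⟩
  obtain ⟨k, hk⟩ := hS.exists_le_outLen n
  obtain ⟨m, hm⟩ := hT.exists_le_outLen k
  refine ⟨m, hk.trans ?_⟩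
  rw [h]
  exact S.outLen_mono τ hm

/-- Each position of the output is written in some step. -/
theorem exists_step (hT : T.Transduces σ τ) {a y : ℕ} (h : T.outLen σ a ≤ y) :
    ∃ s, a ≤ s ∧ T.outLen σ s ≤ y ∧ y < T.outLen σ (s + 1) := by
  obtain ⟨b, hb⟩ := hT.exists_le_outLen (y + 1)
  by_contra! hc
  have : ∀ n, a ≤ n → T.outLen σ n ≤ y := fun n hn => by
    induction n, hn using Nat.le_induction with
    | base => exact h
    | succ n hn ih => exact hc n hn ih
  rcases le_total a b with h1 | h1
  · have := this b h1
    omega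
  · have := T.outLen_mono σ h1
    omega

end Transduces

/-- The word that `T` outputs for the letter of `σ` at position `s`. -/
def emit (T : FST) (σ : BinSeq) (s : ℕ) : List Bool := T.out (T.stateAt σ s) (σ s)

theorem output_window_one (T : FST) (σ : BinSeq) (s : ℕ) :
    T.output (T.stateAt σ s) (σ.window s 1) = T.emit σ s := by
  rw [BinSeq.window_one, output, output, List.append_nil]
  rfl

theorem outLen_succ (T : FST) (σ : BinSeq) (s : ℕ) :
    T.outLen σ (s + 1) = T.outLen σ s + (T.emit σ s).length := by
  rw [outLen_add, output_window_one]

theorem Transduces.window_emit {T : FST} {σ τ : BinSeq} (hT : T.Transduces σ τ) (s : ℕ) :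
    τ.window (T.outLen σ s) (T.emit σ s).length = T.emit σ s := by
  have := hT.window_eq s 1
  rwa [output_window_one] at this

theorem exists_outLen_add_le (T : FST) :
    ∃ A, ∀ (σ : BinSeq) (a m : ℕ), T.outLen σ (a + m) ≤ T.outLen σ a + A * m := by
  have := T.finite
  obtain ⟨A, hA⟩ := (Set.finite_range fun p : T.State × Bool => (T.out p.1 p.2).length).bddAbove
  refine ⟨A, fun σ a m => ?_⟩
  induction m with
  | zero => simp
  | succ m ih =>
    have h : (T.emit σ (a + m)).length ≤ A := hA ⟨(T.stateAt σ (a + m), σ (a + m)), rfl⟩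
    rw [← add_assoc, outLen_succ, Nat.mul_succ]
    omega

/-! ### Transducing a block of zeros. -/

/-- Long runs of zeros have a common period. -/
theorem exists_run_zeros (T : FST) : ∃ h Z, 0 < Z ∧ ∀ q m, h ≤ m →
    T.run q (List.replicate (m + Z) false) = T.run q (List.replicate m false) := by
  have := T.finite
  -- Pigeonhole on self-maps of the state set, which makes `h` and `Z` uniform in the state.
  obtain ⟨a, b, hab, he⟩ := Finite.exists_ne_map_eq_of_infinite
    fun (m : ℕ) (q : T.State) => T.run q (List.replicate m false)
  wlog h : a < b generalizing a b
  · exact this b a hab.symm he.symm (by omega)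
  refine ⟨a, b - a, by omega, fun q m hm => ?_⟩
  obtain ⟨k, rfl⟩ := Nat.exists_eq_add_of_le hm
  rw [show a + k + (b - a) = b + k by omega, List.replicate_add, List.replicate_add, run_append,
    run_append]
  exact congrArg (fun q => T.run q _) (congrFun he q).symm

theorem exists_emit_add_eq (T : FST) : ∃ h Z, 0 < Z ∧ ∀ (σ : BinSeq) (a b : ℕ),
    (∀ k, a < k → k < b → σ k = false) → ∀ s, a + h < s → s + Z < b →
      T.emit σ (s + Z) = T.emit σ s := by
  obtain ⟨h, Z, hZ, hr⟩ := T.exists_run_zeros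
  refine ⟨h, Z, hZ, fun σ a b h0 s h1 h2 => ?_⟩
  have key : ∀ j, a + 1 + j ≤ b →
      T.stateAt σ (a + 1 + j) = T.run (T.stateAt σ (a + 1)) (List.replicate j false) := by
    intro j hj
    rw [stateAt_add, BinSeq.window_eq_replicate fun i hi => h0 _ (by omega) (by omega)]
  obtain ⟨j, rfl⟩ := Nat.exists_eq_add_of_le (show a + 1 ≤ s by omega)
  rw [emit, emit, h0 _ (by omega) (by omega), h0 _ (by omega) (by omega), add_assoc,
    key _ (by omega), key _ (by omega), hr _ _ (by omega)]

/-- In the output for a block `1 0 ⋯ 0`, only boundedly many positions violate a suitable period. -/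
theorem Transduces.exists_ones_xorShift_le {T : FST} {σ τ : BinSeq} (hT : T.Transduces σ τ) :
    ∃ L K, 0 < L ∧ ∀ a b, a ≤ b → (∀ k, a < k → k < b → σ k = false) →
      (τ.xorShift L).ones (T.outLen σ b + L) ≤ (τ.xorShift L).ones (T.outLen σ a + L) + K := by
  obtain ⟨A, hA⟩ := T.exists_outLen_add_le
  obtain ⟨h, Z, hZ, he⟩ := T.exists_emit_add_eq
  -- The output of one loop of `Z` zeros has length at most `A * Z`, so whenever nonzero this length
  -- divides `L`.
  set L := (A * Z).factorial with hL
  have hmono := (τ.xorShift L).ones_mono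
  have hadd := (τ.xorShift L).ones_add_le
  refine ⟨L, A * (h + 1) + A * Z + L, Nat.factorial_pos _, fun a b hab h0 => ?_⟩
  rcases Nat.lt_or_ge b (a + (h + 1) + Z) with hb | hb
  · have h1 := hA σ a (h + 1 + Z)
    have h2 := T.outLen_mono σ (show b ≤ a + (h + 1 + Z) by omega)
    have h3 := hmono (show T.outLen σ b + L ≤ T.outLen σ a + L + (A * (h + 1) + A * Z) by
      rw [Nat.mul_add] at h1
      omega)
    have := hadd (T.outLen σ a + L) (A * (h + 1) + A * Z)
    omega
  · obtain ⟨a', ha'⟩ : ∃ a', a' = a + (h + 1) := ⟨_, rfl⟩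
    obtain ⟨b', rfl⟩ : ∃ b', b = b' + Z := ⟨b - Z, by omega⟩
    obtain ⟨ℓ, hℓ⟩ := Nat.exists_eq_add_of_le (T.outLen_mono σ (show a' ≤ a' + Z by omega))
    obtain ⟨c1, c2⟩ := BinSeq.chunk_shift (T.outLen_succ σ) hT.window_emit
      (show a' ≤ b' by omega) (fun n h1 h2 => he σ a (b' + Z) h0 n (by omega) (by omega)) hℓ
    have h1 := hA σ a (h + 1)
    have h2 := hA σ b' Z
    have h3 := hA σ a' Z
    rw [← ha'] at h1
    have h4 := hmono (show T.outLen σ a' + L ≤ T.outLen σ a + L + A * (h + 1) by omega)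
    have h5 := hadd (T.outLen σ a + L) (A * (h + 1))
    have hbound : (τ.xorShift L).ones (T.outLen σ b' + L) ≤
        (τ.xorShift L).ones (T.outLen σ a' + L) + L := by
      rcases Nat.eq_zero_or_pos ℓ with h0 | hpos
      · subst h0
        rw [BinSeq.chunk_const (T.outLen_mono σ) hZ c1 (show a' ≤ b' by omega) le_rfl]
        omega
      · have hdvd : ℓ ∣ L := Nat.dvd_factorial hpos (by omega)
        have hper : ∀ j k, T.outLen σ a' ≤ k → k + ℓ * j < T.outLen σ b' + ℓ →
            τ (k + ℓ * j) = τ k := by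
          intro j k hk
          induction j with
          | zero => simp
          | succ j ih =>
            intro h6
            rw [Nat.mul_succ] at h6
            rw [Nat.mul_succ, ← add_assoc, c2 _ (by omega) (by omega), ih (by omega)]
        obtain ⟨j, hj⟩ := hdvd
        rcases le_total (T.outLen σ b') (T.outLen σ a' + L) with h6 | h6
        · have := hmono (show T.outLen σ b' + L ≤ T.outLen σ a' + L + L by omega)
          have := hadd (T.outLen σ a' + L) L
          omega
        · have := hadd (T.outLen σ b') L
          rw [BinSeq.ones_eq_of_false h6 fun k h7 h8 => ?_] at this
          · exact this
          · obtain ⟨k, rfl⟩ := Nat.exists_eq_add_of_le (show L ≤ k by omega)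
            rw [add_comm L k, BinSeq.xorShift_add, hj]
            exact hper j k (by omega) (by rw [← hj]; omega)
    have h6 := hmono (show T.outLen σ (b' + Z) + L ≤ T.outLen σ b' + L + A * Z by omega)
    have h7 := hadd (T.outLen σ b' + L) (A * Z)
    omega

/-- From some point on, each block `1 0 ⋯ 0` of the input produces at most one of the ones of a
sparse sequence. -/
theorem Transduces.exists_ones_le_succ {T : FST} {σ τ : BinSeq} (hT : T.Transduces σ τ)
    (hτ : τ.IsSparse) :
    ∃ X, ∀ a b, a ≤ b → X ≤ T.outLen σ a → (∀ k, a < k → k < b → σ k = false) →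
      τ.ones (T.outLen σ b) ≤ τ.ones (T.outLen σ a) + 1 := by
  obtain ⟨A, hA⟩ := T.exists_outLen_add_le
  obtain ⟨h, Z, hZ, he⟩ := T.exists_emit_add_eq
  -- Two ones written within `h + Z` steps of each other are too close. If the steps are further
  -- apart, the later one is repeated `Z` steps earlier, again too close.
  obtain ⟨X, hX⟩ := hτ (A * (h + Z + 1))
  refine ⟨X, fun a b hab hXa h0 => ?_⟩
  have two : ∀ y z, T.outLen σ a ≤ y → y < z → z < T.outLen σ b → τ y = true → τ z = true →
      False := by
    intro y z hy hyz hz ty tz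
    have h1 := hX y z (by omega) hyz ty tz
    obtain ⟨s, hs1, hs2, hs3⟩ := hT.exists_step hy
    obtain ⟨t, ht1, ht2, ht3⟩ := hT.exists_step (hs2.trans hyz.le)
    have htb : t < b := by
      by_contra! h2
      have := T.outLen_mono σ h2
      omega
    rcases Nat.lt_or_ge (s + h + Z) t with hst | hst
    · obtain ⟨t', rfl⟩ : ∃ t', t = t' + Z := ⟨t - Z, by omega⟩
      have h2 := he σ a b h0 t' (by omega) htb
      obtain ⟨i, rfl⟩ := Nat.exists_eq_add_of_le ht2
      rw [outLen_succ] at ht3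
      have hi : i < (T.emit σ (t' + Z)).length := by omega
      have h3 := (BinSeq.window_eq_iff rfl).1 (hT.window_emit (t' + Z)) i hi
      have h4 := (BinSeq.window_eq_iff rfl).1 (hT.window_emit t') i (by rw [← h2]; exact hi)
      have h5 : τ (T.outLen σ t' + i) = true := by
        rw [h4, ← tz, h3]
        simp only [h2]
      have h6 := T.outLen_mono σ (show a ≤ t' by omega)
      have h7 := T.outLen_succ σ t'
      have h8 := T.outLen_mono σ (show t' + 1 ≤ t' + Z by omega)
      have h9 := hX _ _ (by omega) (show T.outLen σ t' + i < T.outLen σ (t' + Z) + i by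
        rw [← h2] at h7
        omega) h5 tz
      have h10 := hA σ t' Z
      have h11 := Nat.mul_le_mul_left A (show Z ≤ h + Z + 1 by omega)
      omega
    · have h2 := T.outLen_mono σ (show t + 1 ≤ s + (h + Z + 1) by omega)
      have h3 := hA σ s (h + Z + 1)
      omega
  by_cases hex : ∃ y, T.outLen σ a ≤ y ∧ y < T.outLen σ b ∧ τ y = true
  · obtain ⟨y, h1, h2, h3⟩ := hex
    have e1 : τ.ones y = τ.ones (T.outLen σ a) := BinSeq.ones_eq_of_false h1 fun k h4 h5 => by
      by_contra h6
      exact two k y h4 h5 h2 (by simpa using h6) h3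
    have e2 : τ.ones (T.outLen σ b) = τ.ones (y + 1) :=
      BinSeq.ones_eq_of_false h2 fun k h4 h5 => by
        by_contra h6
        exact two y k h1 h4 h5 h3 (by simpa using h6)
    rw [e2, BinSeq.ones_succ, e1, if_pos h3]
  · push Not at hex
    rw [BinSeq.ones_eq_of_false (T.outLen_mono σ hab) fun k h4 h5 => by simpa using hex k h4 h5]
    omega

/-- Induction on the last input one before `M`: the stretch from it to `M` adds at most one output
one. The constant absorbs the start. -/
theorem Transduces.exists_ones_le_ones {T : FST} {σ τ : BinSeq} (hT : T.Transduces σ τ)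
    (hτ : τ.IsSparse) : ∃ C, ∀ M, τ.ones (T.outLen σ M) ≤ σ.ones M + C := by
  obtain ⟨X, hX⟩ := hT.exists_ones_le_succ hτ
  obtain ⟨a₀, ha₀⟩ := hT.exists_le_outLen X
  refine ⟨τ.ones (T.outLen σ a₀) + 1, fun M => ?_⟩
  induction M using Nat.strong_induction_on with
  | _ M ih =>
    rcases le_total M a₀ with h1 | h1
    · have := τ.ones_mono (T.outLen_mono σ h1)
      omega
    · by_cases hex : ∃ k, a₀ ≤ k ∧ k < M ∧ σ k = true
      · obtain ⟨k, hk, hmax⟩ : ∃ k, (a₀ ≤ k ∧ k < M ∧ σ k = true) ∧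
            ∀ j, k < j → j < M → σ j = false := by
          clear ih hX ha₀
          induction M, h1 using Nat.le_induction with
          | base => obtain ⟨k, h2, h3, h4⟩ := hex; omega
          | succ M hM ih =>
            by_cases h2 : σ M = true
            · exact ⟨M, ⟨hM, by omega, h2⟩, fun j h3 h4 => by omega⟩
            · obtain ⟨k, h3, h4, h5⟩ := hex
              have h6 : k ≠ M := fun h => h2 (h ▸ h5)
              obtain ⟨k, hk, hj⟩ := ih ⟨k, h3, by omega, h5⟩
              refine ⟨k, ⟨hk.1, by omega, hk.2.2⟩, fun j h7 h8 => ?_⟩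
              rcases Nat.lt_or_ge j M with h9 | h9
              · exact hj j h7 h9
              · obtain rfl : j = M := by omega
                simpa using h2
        have h2 := hX k M hk.2.1.le (ha₀.trans (T.outLen_mono σ hk.1)) hmax
        have h3 := ih k hk.2.1
        have h4 := BinSeq.ones_lt hk.2.1 hk.2.2
        omega
      · push Not at hex
        have := hX a₀ M h1 ha₀ fun k h2 h3 => by simpa using hex k h2.le h3
        omega

end FST

/-! ### Recognizing nonzero degrees. -/

namespace BinSeq

theorem not_le_zeros {τ : BinSeq} (h : τ.IsSparse) (h' : τ.HasManyOnes) : ¬ τ ≤ zeros := by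
  rintro ⟨T, hT⟩
  obtain ⟨C, hC⟩ := hT.exists_ones_le_ones h
  obtain ⟨m, hm⟩ := h'.exists_ones (C + 1)
  obtain ⟨M, hM⟩ := hT.exists_le_outLen m
  have h1 := hC M
  have h2 := τ.ones_mono hM
  have h3 : zeros.ones M = zeros.ones 0 := ones_eq_of_false (Nat.zero_le _) fun _ _ _ => rfl
  rw [h3, show zeros.ones 0 = 0 from rfl] at h1
  omega

theorem hasManyOnes_xorShift {τ : BinSeq} (h : ¬ τ ≤ zeros) {L : ℕ} (hL : 0 < L) :
    (τ.xorShift L).HasManyOnes := by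
  intro n
  by_contra! hc
  refine h (le_zeros_of_periodic (k₀ := n) hL fun k hk => ?_)
  rw [← xorShift_add]
  simpa using hc (k + L) (by omega)

end BinSeq

/-! ### The block structure of `powTwo`. -/

namespace BinSeq

/-- The starting position of the `n`-th block of `ofBlocks f`. -/
def blockStart (f : ℕ → ℕ) : ℕ → ℕ
  | 0 => 0
  | n + 1 => blockStart f n + (f n + 1)

theorem ofBlocks_blockStart_add (f : ℕ → ℕ) (n i : ℕ) (hi : i ≤ f n) :
    ofBlocks f (blockStart f n + i) = decide (i = 0) := by
  set cat : ℕ → List Bool := fun m =>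
    (List.range m).flatMap fun i => true :: List.replicate (f i) false with hcat
  have hsucc : ∀ m, cat (m + 1) = cat m ++ (true :: List.replicate (f m) false) := fun m => by
    simp [hcat, List.range_succ]
  have hlen : ∀ m, (cat m).length = blockStart f m := fun m => by
    induction m with
    | zero => rfl
    | succ m ih => rw [hsucc, List.length_append, ih]; simp [blockStart]
  have hle : ∀ m, m ≤ blockStart f m := fun m => by
    induction m with
    | zero => exact le_rfl
    | succ m ih => simp only [blockStart]; omega
  have hext : ∀ k m j, k < blockStart f m →
      (cat (m + j)).getD k false = (cat m).getD k false := fun k m j hk => by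
    induction j with
    | zero => rfl
    | succ j ih =>
      have : (cat m).length ≤ (cat (m + j)).length := by
        clear ih
        induction j with
        | zero => exact le_rfl
        | succ j ih => rw [← add_assoc, hsucc, List.length_append]; omega
      rw [← add_assoc, hsucc, List.getD_append _ _ _ _ (by rw [hlen] at this; omega), ih]
  set k := blockStart f n + i with hk
  have h1 : ofBlocks f k = (cat (k + 1)).getD k false := rfl
  have h2 : k < blockStart f (n + 1) := by simp only [blockStart]; omega
  -- Both concatenations already cover position `k`, so each agrees there with a common extension.
  have h3 : (cat (k + 1)).getD k false = (cat (n + 1)).getD k false := by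
    have ha := hext k (k + 1) (n + 1) (by have := hle (k + 1); omega)
    have hb := hext k (n + 1) (k + 1) h2
    rw [← ha, ← hb, add_comm]
  rw [h1, h3, hsucc, List.getD_append_right _ _ _ _ (by rw [hlen]; omega), hlen,
    show k - blockStart f n = i by omega]
  cases i with
  | zero => rfl
  | succ i => simp

/-- The sequence `1 0^{2^0} 1 0^{2^1} 1 0^{2^2} ⋯`. -/
abbrev powTwo : BinSeq := ofBlocks fun n => 2 ^ n

/-- The starting position of the `n`-th block of `powTwo`. -/
abbrev powStart : ℕ → ℕ := blockStart fun n => 2 ^ n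

theorem powStart_succ (n : ℕ) : powStart (n + 1) = powStart n + (2 ^ n + 1) := rfl

theorem powStart_add_one (n : ℕ) : powStart n + 1 = n + 2 ^ n := by
  induction n with
  | zero => rfl
  | succ n ih => rw [powStart_succ, pow_succ]; omega

theorem powStart_le (n : ℕ) : powStart n ≤ 2 * 2 ^ n := by
  have h1 := powStart_add_one n
  have h2 : n < 2 ^ n := Nat.lt_two_pow_self
  omega

theorem powStart_mono : Monotone powStart :=
  monotone_nat_of_le_succ fun _ => Nat.le_add_right _ _

theorem le_powStart (n : ℕ) : n ≤ powStart n := by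
  have h1 := powStart_add_one n
  have h2 : 0 < 2 ^ n := by positivity
  omega

theorem powTwo_powStart (n : ℕ) : powTwo (powStart n) = true := by
  simpa using ofBlocks_blockStart_add (fun n => 2 ^ n) n 0 (Nat.zero_le _)

theorem powTwo_eq_false {n k : ℕ} (h1 : powStart n < k) (h2 : k < powStart (n + 1)) :
    powTwo k = false := by
  obtain ⟨i, rfl⟩ := Nat.exists_eq_add_of_le h1.le
  rw [powStart_succ] at h2
  rw [powTwo, ofBlocks_blockStart_add _ n i (by omega)]
  simp
  omega

theorem window_powTwo (n : ℕ) :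
    powTwo.window (powStart n) (2 ^ n + 1) = true :: List.replicate (2 ^ n) false := by
  rw [window_eq_iff (by simp)]
  intro i hi
  simp only [List.length_cons, List.length_replicate] at hi
  rw [powTwo, ofBlocks_blockStart_add _ n i (by omega)]
  cases i <;> simp

theorem exists_eq_powStart {k : ℕ} (h : powTwo k = true) : ∃ n, k = powStart n := by
  by_contra! hc
  have : ∀ n, powStart n ≤ k := fun n => by
    induction n with
    | zero => exact Nat.zero_le _
    | succ n ih =>
      by_contra! h1
      rw [powTwo_eq_false (lt_of_le_of_ne ih (hc n).symm) h1] at h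
      exact absurd h (by simp)
  have h1 := this (k + 1)
  have h2 := le_powStart (k + 1)
  omega

theorem hasManyOnes_powTwo : powTwo.HasManyOnes := fun n =>
  ⟨powStart n, le_powStart n, powTwo_powStart n⟩

theorem isSparse_powTwo : powTwo.IsSparse := by
  intro D
  refine ⟨powStart D, fun y z h1 h2 h3 h4 => ?_⟩
  obtain ⟨n, rfl⟩ := exists_eq_powStart h3
  obtain ⟨m, rfl⟩ := exists_eq_powStart h4
  have h5 : n < m := by
    by_contra! h5
    have := powStart_mono h5
    omega
  have h6 := powStart_mono (show n + 1 ≤ m from h5)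
  rw [powStart_succ] at h6
  have h7 : D < 2 ^ D := Nat.lt_two_pow_self
  have h8 : 2 ^ D ≤ 2 ^ n := by
    rcases le_or_gt D n with h | h
    · exact Nat.pow_le_pow_right (by norm_num) h
    · have := powStart_mono (show n + 1 ≤ D from h)
      rw [powStart_succ] at this
      have : 0 < 2 ^ n := by positivity
      omega
  omega

end BinSeq

/-! ### Output growth on `powTwo`. -/

namespace FST

open BinSeq

theorem length_output_zeros (T : FST) {r : T.State} {Z : ℕ}
    (hr : T.run r (List.replicate Z false) = r) (m : ℕ) :
    (T.output r (List.replicate (Z * m) false)).length =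
      m * (T.output r (List.replicate Z false)).length := by
  induction m with
  | zero => simp [output]
  | succ m ih =>
    rw [Nat.mul_succ, add_comm, List.replicate_add, output_append, List.length_append, hr, ih]
    ring

theorem length_output_zeros_mono (T : FST) (r : T.State) {m n : ℕ} (h : m ≤ n) :
    (T.output r (List.replicate m false)).length ≤
      (T.output r (List.replicate n false)).length := by
  obtain ⟨k, rfl⟩ := Nat.exists_eq_add_of_le h
  rw [List.replicate_add, output_append, List.length_append]
  omega

theorem run_zeros_congr (T : FST) {h Z : ℕ}
    (hr : ∀ q m, h ≤ m → T.run q (List.replicate (m + Z) false) = T.run q (List.replicate m false))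
    {m n : ℕ} (hm : h ≤ m) (hn : h ≤ n) (hmn : m ≡ n [MOD Z]) (q : T.State) :
    T.run q (List.replicate m false) = T.run q (List.replicate n false) := by
  wlog hle : m ≤ n generalizing m n
  · exact (this hn hm hmn.symm (by omega)).symm
  obtain ⟨j, hj⟩ := (Nat.modEq_iff_dvd' hle).1 hmn
  obtain rfl : n = m + Z * j := by omega
  clear hmn hj hle hn
  induction j with
  | zero => rfl
  | succ j ih => rw [Nat.mul_succ, ← add_assoc, hr _ _ (by omega), ih]

/-- A transducer that does not map `powTwo` to an ultimately periodic sequence has an output of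
linear growth. -/
theorem Transduces.exists_two_pow_le {T : FST} {τ : BinSeq} (hT : T.Transduces powTwo τ)
    (hτ : ¬ τ ≤ zeros) :
    ∃ D n₀, ∀ n, n₀ ≤ n → 2 ^ n ≤ D * T.outLen powTwo (powStart n) := by
  obtain ⟨h, Z, hZ, hr⟩ := T.exists_run_zeros
  have := T.finite
  have : NeZero Z := ⟨hZ.ne'⟩
  obtain ⟨q, hq⟩ : ∃ q : ℕ → T.State, q = fun n => T.stateAt powTwo (powStart n) := ⟨_, rfl⟩
  obtain ⟨W, hW⟩ : ∃ W : ℕ → List Bool,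
    W = fun n => T.output (q n) (true :: List.replicate (2 ^ n) false) := ⟨_, rfl⟩
  obtain ⟨P, hPdef⟩ : ∃ P : ℕ → ℕ, P = fun n => T.outLen powTwo (powStart n) := ⟨_, rfl⟩
  have hq1 : ∀ n, q (n + 1) = T.run (q n) (true :: List.replicate (2 ^ n) false) := fun n => by
    simp only [hq]
    rw [powStart_succ, stateAt_add, window_powTwo]
  have hP1 : ∀ n, P (n + 1) = P n + (W n).length := fun n => by
    simp only [hPdef, hW, hq]
    rw [powStart_succ, outLen_add, window_powTwo]
  have hPW : ∀ n, τ.window (P n) (W n).length = W n := fun n => by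
    have := hT.window_eq (powStart n) (2 ^ n + 1)
    rw [window_powTwo] at this
    simpa only [hPdef, hW, hq] using this
  have hPmono : Monotone P := monotone_nat_of_le_succ fun n => by rw [hP1]; omega
  have hPunb : ∀ n, ∃ m, n ≤ P m := fun n => by
    obtain ⟨m, hm⟩ := hT.exists_le_outLen n
    exact ⟨m, hm.trans (by rw [hPdef]; exact T.outLen_mono _ (le_powStart m))⟩
  have hpow : ∀ n, h ≤ n → h ≤ 2 ^ n := fun n hn => hn.trans Nat.lt_two_pow_self.le
  -- For blocks of at least `h` zeros, the state at the block start and the block length modulo `Z`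
  -- determine the next such pair. One repetition therefore forces periodicity.
  obtain ⟨n₁, d, hn₁, hd, hper⟩ : ∃ n₁ d, h ≤ n₁ ∧ 0 < d ∧
      ∀ n, n₁ ≤ n → q (n + d) = q n ∧ 2 ^ (n + d) ≡ 2 ^ n [MOD Z] := by
    obtain ⟨a, b, hab, he⟩ := Finite.exists_ne_map_eq_of_infinite
      fun n : ℕ => (q (n + h), ((2 ^ (n + h) : ℕ) : ZMod Z))
    wlog hlt : a < b generalizing a b
    · exact this b a hab.symm he.symm (by omega)
    refine ⟨a + h, b - a, by omega, by omega, fun n hn => ?_⟩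
    induction n, hn using Nat.le_induction with
    | base =>
      rw [show a + h + (b - a) = b + h by omega]
      exact ⟨(congrArg Prod.fst he).symm,
        (ZMod.natCast_eq_natCast_iff _ _ _).1 (congrArg Prod.snd he).symm⟩
    | succ n hn ih =>
      rw [show n + 1 + (b - a) = n + (b - a) + 1 by ring, hq1, hq1, ih.1, pow_succ, pow_succ]
      exact ⟨T.run_zeros_congr hr (hpow _ (by omega)) (hpow _ (by omega)) ih.2 _,
        ih.2.mul_right 2⟩
  obtain ⟨r, hrdef⟩ : ∃ r : ℕ → T.State,
    r = fun n => T.run (q n) (true :: List.replicate h false) := ⟨_, rfl⟩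
  have hrr : ∀ n, T.run (r n) (List.replicate Z false) = r n := fun n => by
    have := hr (T.step (q n) true) h le_rfl
    rw [List.replicate_add, run_append] at this
    simpa only [hrdef, run] using this
  have hWr : ∀ n, h ≤ n → W n = T.output (q n) (true :: List.replicate h false) ++
      T.output (r n) (List.replicate (2 ^ n - h) false) := fun n hn => by
    have := hpow n hn
    simp only [hW, hrdef]
    rw [← output_append, List.cons_append, ← List.replicate_add, Nat.add_sub_cancel' this]
  -- If some loop writes a letter, it recurs every `d` blocks and gives linear output. If all loops
  -- are silent, the words `W n` repeat with period `d`, and `τ` is ultimately periodic.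
  by_cases hcase : ∃ N, n₁ ≤ N ∧ 0 < (T.output (r N) (List.replicate Z false)).length
  · obtain ⟨N, hN, hpos⟩ := hcase
    have hqi : ∀ i, q (N + d * i) = q N := fun i => by
      induction i with
      | zero => rfl
      | succ i ih => rw [Nat.mul_succ, ← add_assoc, (hper _ (by omega)).1, ih]
    have hlow : ∀ i, 2 ^ (N + d * i) ≤ h + Z + Z * P (N + d * i + 1) := fun i => by
      obtain ⟨n, hn⟩ : ∃ n, n = N + d * i := ⟨_, rfl⟩
      have h1 : r n = r N := by simp only [hrdef, hn, hqi]
      have h2 := T.length_output_zeros (hrr n) ((2 ^ n - h) / Z)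
      have h3 := T.length_output_zeros_mono (r n) (Nat.mul_div_le (2 ^ n - h) Z)
      have h4 : (2 ^ n - h) / Z ≤ P (n + 1) := by
        rw [hP1, hWr n (by omega), List.length_append]
        rw [← h1] at hpos
        have := Nat.le_mul_of_pos_right ((2 ^ n - h) / Z) hpos
        omega
      have h5 := Nat.mul_le_mul_left Z h4
      have h6 := Nat.div_add_mod (2 ^ n - h) Z
      have h7 := Nat.mod_lt (2 ^ n - h) hZ
      rw [← hn]
      omega
    obtain ⟨m, hm⟩ := hPunb 1
    refine ⟨2 ^ d * (h + Z + Z), N + 1 + m, fun n hn => ?_⟩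
    -- Block `N + d * i` is the last recurrence before block `n`; it is at most `d` blocks back,
    -- whence the factor `2 ^ d`.
    obtain ⟨i, hi⟩ : ∃ i, i = (n - 1 - N) / d := ⟨_, rfl⟩
    have h1 := Nat.div_add_mod (n - 1 - N) d
    have h2 := Nat.mod_lt (n - 1 - N) hd
    rw [← hi] at h1
    have h3 := hlow i
    have h4 : P (N + d * i + 1) ≤ P n := hPmono (by omega)
    have h5 : 1 ≤ P n := hm.trans (hPmono (by omega))
    have h6 : 2 ^ n ≤ 2 ^ d * 2 ^ (N + d * i) := by
      rw [← pow_add]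
      exact Nat.pow_le_pow_right (by norm_num) (by omega)
    have h7 : h + Z + Z * P (N + d * i + 1) ≤ (h + Z + Z) * P n := by
      have := Nat.mul_le_mul_left Z h4
      have := Nat.le_mul_of_pos_right (h + Z) h5
      rw [Nat.add_mul]
      omega
    have hPn : T.outLen powTwo (powStart n) = P n := by rw [hPdef]
    rw [hPn, mul_assoc]
    exact h6.trans (Nat.mul_le_mul_left _ (h3.trans h7))
  · exfalso
    push Not at hcase
    have hW0 : ∀ n, n₁ ≤ n → W n = T.output (q n) (true :: List.replicate h false) := by
      intro n hn
      have h1 := T.length_output_zeros (hrr n) (2 ^ n - h)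
      have h2 := T.length_output_zeros_mono (r n)
        (Nat.le_mul_of_pos_left (2 ^ n - h) hZ)
      rw [h1, Nat.le_zero.1 (hcase n hn), Nat.mul_zero, Nat.le_zero, List.length_eq_zero_iff] at h2
      rw [hWr n (by omega), h2, List.append_nil]
    have hWd : ∀ n, n₁ ≤ n → W (n + d) = W n := fun n hn => by
      rw [hW0 n hn, hW0 (n + d) (by omega), (hper n hn).1]
    obtain ⟨ℓ, hℓ⟩ := Nat.exists_eq_add_of_le (hPmono (show n₁ ≤ n₁ + d by omega))
    have hshift := fun b hb => chunk_shift hP1 hPW (show n₁ ≤ b from hb)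
      (fun n h1 _ => hWd n h1) hℓ
    rcases Nat.eq_zero_or_pos ℓ with h0 | hpos
    · subst h0
      obtain ⟨m, hm⟩ := hPunb (P n₁ + 1)
      have h1 := hPmono (show m ≤ n₁ + m by omega)
      have h2 := chunk_const hPmono hd (hshift (n₁ + m) (by omega)).1
        (show n₁ ≤ n₁ + m by omega) le_rfl
      omega
    · refine hτ (le_zeros_of_periodic (k₀ := P n₁) hpos fun k hk => ?_)
      obtain ⟨m, hm⟩ := hPunb (k + 1)
      have h1 := hPmono (show m ≤ n₁ + m by omega)
      exact (hshift (n₁ + m) (by omega)).2 k hk (by omega)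

theorem Transduces.exists_hasLogOnes {T : FST} {τ : BinSeq} (hT : T.Transduces powTwo τ)
    (hτ : ¬ τ ≤ zeros) : ∃ L, 0 < L ∧ (τ.xorShift L).HasLogOnes := by
  obtain ⟨L, K, hL, hK⟩ := hT.exists_ones_xorShift_le
  obtain ⟨D, n₀, hD⟩ := hT.exists_two_pow_le hτ
  obtain ⟨A, hA⟩ := T.exists_outLen_add_le
  obtain ⟨P, hPdef⟩ : ∃ P : ℕ → ℕ, P = fun n => T.outLen powTwo (powStart n) := ⟨_, rfl⟩
  have hPmono : Monotone P := fun a b hab => by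
    rw [hPdef]; exact T.outLen_mono _ (powStart_mono hab)
  have hPn : ∀ n, T.outLen powTwo (powStart n) = P n := fun n => by rw [hPdef]
  have hPup : ∀ n, P n ≤ A * 2 * 2 ^ n := fun n => by
    have h1 := hA powTwo 0 (powStart n)
    rw [zero_add, hPn, show T.outLen powTwo 0 = 0 from rfl, zero_add] at h1
    rw [mul_assoc]
    exact h1.trans (Nat.mul_le_mul_left A (powStart_le n))
  have hblock : ∀ n j, (τ.xorShift L).ones (P (n + j) + L) ≤
      (τ.xorShift L).ones (P n + L) + j * K := fun n j => by
    induction j with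
    | zero => simp
    | succ j ih =>
      have := hK (powStart (n + j)) (powStart (n + j + 1)) (powStart_mono (by omega))
        fun k h1 h2 => powTwo_eq_false h1 h2
      rw [hPn, hPn] at this
      rw [Nat.succ_mul, ← add_assoc]
      omega
  -- Since `j < 2 ^ j`, advancing by `j` blocks outweighs both the constant `D` and the upper bound
  -- `2 * (A * 4 + L) * 2 ^ n` on `2 * M`.
  obtain ⟨j, hj⟩ : ∃ j, j = D * (2 * (A * 4 + L)) := ⟨_, rfl⟩
  refine ⟨L, hL, j * K, P n₀ + L, fun M hM => ?_⟩
  obtain ⟨n, hn, hn1, hn2⟩ : ∃ n, n₀ ≤ n ∧ P n + L ≤ M ∧ M < P (n + 1) + L := by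
    by_contra! hc
    have : ∀ n, n₀ ≤ n → P n + L ≤ M := fun n hn => by
      induction n, hn using Nat.le_induction with
      | base => exact hM
      | succ n hn ih => exact hc n hn ih
    obtain ⟨m, hm⟩ := hT.exists_le_outLen (M + 1)
    have h1 := this (n₀ + m) (by omega)
    have h2 := T.outLen_mono powTwo ((le_powStart m).trans
      (powStart_mono (show m ≤ n₀ + m by omega)))
    rw [hPn] at h2
    omega
  have h1 : 2 * M ≤ P (n + j) := by
    have h2 := hPup (n + 1)
    have h3 := hD (n + j) (by omega)
    rw [hPn, pow_add] at h3
    have h4 : j < 2 ^ j := Nat.lt_two_pow_self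
    have h5 : 0 < 2 ^ n := by positivity
    have h6 : 2 * M ≤ 2 * (A * 4 + L) * 2 ^ n := by
      rw [pow_succ] at h2
      nlinarith
    have h7 : D * (2 * (A * 4 + L) * 2 ^ n) ≤ D * P (n + j) := by
      refine le_trans ?_ h3
      rw [← mul_assoc, ← hj, mul_comm]
      exact Nat.mul_le_mul_left _ h4.le
    rcases Nat.eq_zero_or_pos D with h8 | h8
    · rw [h8] at h3
      have := Nat.mul_pos h5 (show 0 < 2 ^ j by positivity)
      omega
    · exact h6.trans (Nat.le_of_mul_le_mul_left h7 h8)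
  have h2 := (τ.xorShift L).ones_mono (show 2 * M ≤ P (n + j) + L by omega)
  have h3 := (τ.xorShift L).ones_mono hn1
  have h4 := hblock n j
  omega

end FST

/-! ### Strict descent. -/

namespace BinSeq

theorem not_le_thin_two {ρ : BinSeq} (h : thin 2 ρ ≤ powTwo) (hs : ρ.IsSparse)
    (hm : ρ.HasManyOnes) (hl : ρ.HasLogOnes) : ¬ ρ ≤ thin 2 ρ := by
  rintro ⟨S, hS⟩
  obtain ⟨W, hW⟩ := h
  -- Linear growth is known only for input `powTwo`, hence the composite. As `W` expands at most
  -- linearly, the output of `S` is linear in its own input at the images of block starts.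
  obtain ⟨D, n₀, hD⟩ := (hS.comp hW).exists_two_pow_le (not_le_zeros hs hm)
  obtain ⟨A, hA⟩ := W.exists_outLen_add_le
  obtain ⟨C, hC⟩ := hS.exists_ones_le_ones hs
  obtain ⟨C', X, hC'⟩ := hl.mul (A * 2 * D)
  obtain ⟨m₀, hm₀⟩ := hS.exists_le_outLen X
  -- With `x = ρ.ones M`, the estimates below give `2 * x ≤ x + 1 + 2 * C + 2 * C'`; this threshold
  -- violates that.
  obtain ⟨m₁, hm₁⟩ := hm.exists_ones (2 * C + 2 * C' + 2)
  obtain ⟨m, hm⟩ := hW.exists_le_outLen (m₀ + m₁)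
  obtain ⟨n, hn⟩ : ∃ n, n = n₀ + m := ⟨_, rfl⟩
  obtain ⟨M, hM⟩ : ∃ M, M = W.outLen powTwo (powStart n) := ⟨_, rfl⟩
  have hMm : m₀ + m₁ ≤ M := by
    rw [hM]
    exact hm.trans (W.outLen_mono _ ((show m ≤ n by omega).trans (le_powStart n)))
  have h1 := hD n (by omega)
  rw [FST.outLen_comp S W hW, ← hM] at h1
  have h2 := hA powTwo 0 (powStart n)
  rw [zero_add, ← hM, show W.outLen powTwo 0 = 0 from rfl, zero_add] at h2
  have h3 : M ≤ A * 2 * D * S.outLen (thin 2 ρ) M := by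
    calc M ≤ A * (2 * 2 ^ n) := h2.trans (Nat.mul_le_mul_left A (powStart_le n))
      _ ≤ A * (2 * (D * S.outLen (thin 2 ρ) M)) :=
        Nat.mul_le_mul_left A (Nat.mul_le_mul_left 2 h1)
      _ = _ := by ring
  have h4 := hC' (S.outLen (thin 2 ρ) M) (hm₀.trans (S.outLen_mono _ (by omega)))
  have h5 := ρ.ones_mono h3
  have h6 := hC M
  have h7 := two_mul_ones_thin_le ρ M
  have h8 := ρ.ones_mono (show m₁ ≤ M by omega)
  omega

theorem exists_lt_of_le_powTwo {τ : BinSeq} (h : τ ≤ powTwo) (hτ : ¬ τ ≤ zeros) :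
    ∃ ρ, ρ < τ ∧ ¬ ρ ≤ zeros := by
  obtain ⟨T, hT⟩ := h
  obtain ⟨L, hL, hlog⟩ := hT.exists_hasLogOnes hτ
  obtain ⟨n, hn, hsparse⟩ := hlog.exists_thin_isSparse
  have hmany := (hasManyOnes_xorShift hτ hL).thin hn
  have hle : thin n (τ.xorShift L) ≤ τ := (thin_le hn _).trans (xorShift_le hL τ)
  have hle₂ := (thin_le two_pos (thin n (τ.xorShift L))).trans hle
  exact ⟨thin 2 (thin n (τ.xorShift L)), ⟨hle₂, fun h' =>
    not_le_thin_two (hle₂.trans ⟨T, hT⟩) hsparse hmany (hlog.thin n) (hle.trans h')⟩,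
    not_le_zeros (hsparse.thin 2) (hmany.thin two_pos)⟩

theorem degree_le_degree {σ τ : BinSeq} : σ.degree ≤ τ.degree ↔ σ ≤ τ :=
  toAntisymmetrization_le_toAntisymmetrization_iff

theorem degree_lt_degree {σ τ : BinSeq} : σ.degree < τ.degree ↔ σ < τ :=
  toAntisymmetrization_lt_toAntisymmetrization_iff

theorem degree_eq_bot {τ : BinSeq} : τ.degree = ⊥ ↔ τ ≤ zeros := by
  rw [← le_bot_iff]
  exact degree_le_degree

theorem not_isAtom_of_le_powTwo {d : Degree} (hd : d ≤ powTwo.degree) : ¬ IsAtom d := by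
  induction d using Antisymmetrization.ind with
  | _ τ =>
    rintro ⟨h1, h2⟩
    obtain ⟨ρ, hρ, hρ'⟩ := exists_lt_of_le_powTwo (degree_le_degree.1 hd)
      fun h => h1 (degree_eq_bot.2 h)
    exact hρ' (degree_eq_bot.1 (h2 _ (degree_lt_degree.2 hρ)))

end BinSeq

theorem mainTheorem4 :
    (BinSeq.ofBlocks fun n => 2 ^ n).degree ≠ ⊥ ∧
    ¬ IsAtom (BinSeq.ofBlocks fun n => 2 ^ n).degree ∧
    (∀ d : Degree, d ≤ (BinSeq.ofBlocks fun n => 2 ^ n).degree → ¬ IsAtom d) ∧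
    (∀ τ : BinSeq, (BinSeq.ofBlocks fun n => 2 ^ n).TransducesTo τ → τ.degree ≠ ⊥ →
      ∃ c : ℕ → Degree, c 0 = τ.degree ∧ StrictAnti c) := by
  refine ⟨fun h => BinSeq.not_le_zeros BinSeq.isSparse_powTwo BinSeq.hasManyOnes_powTwo
    (BinSeq.degree_eq_bot.1 h), BinSeq.not_isAtom_of_le_powTwo le_rfl,
    fun d hd => BinSeq.not_isAtom_of_le_powTwo hd, fun τ hτ hτ' => ?_⟩
  have step : ∀ p : {ρ : BinSeq // ρ ≤ BinSeq.powTwo ∧ ¬ ρ ≤ BinSeq.zeros},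
      ∃ p' : {ρ : BinSeq // ρ ≤ BinSeq.powTwo ∧ ¬ ρ ≤ BinSeq.zeros}, p'.1 < p.1 := by
    rintro ⟨ρ, h1, h2⟩
    obtain ⟨ρ', h3, h4⟩ := BinSeq.exists_lt_of_le_powTwo h1 h2
    exact ⟨⟨ρ', h3.le.trans h1, h4⟩, h3⟩
  choose next hnext using step
  refine ⟨fun n => (next^[n] ⟨τ, hτ, fun h => hτ' (BinSeq.degree_eq_bot.2 h)⟩).1.degree, rfl,
    strictAnti_nat_of_succ_lt fun n => ?_⟩
  rw [Function.iterate_succ_apply']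
  exact BinSeq.degree_lt_degree.2 (hnext _)
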